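/- \textbf{Terminology.} An inverse monoid is regarded as an algebra in the signature $(\cdot,1,{}^{-1})$; its natural partial order is $a\le b \iff a=aa^{-1}b$, and $\sigma$ is its least group congruence ($a\mathrel\sigma b$ iff $a,b$ have a common lower bound), so $S/\sigma$ is the greatest group image of $S$. An $F$-inverse monoid is an inverse monoid in which every $\sigma$-class has a greatest element; it is regarded as an algebra in the signature $(\cdot,1,{}^{-1},{}^{\mathfrak m})$, where $s^{\mathfrak m}$ is the greatest element of the $\sigma$-class of $s$. These algebras form a variety. Let $X$ be a set and let $\mathbb I\mathfrak m_X$ be the set of formal expressions $u_0v_1^{\mathfrak m}u_1\cdots v_n^{\mathfrak m}u_n$ with $n\ge 0$ and $u_i,v_i\in(X\cup X^{-1})^*$. For a map of $X$ into an $F$-inverse monoid $S$, $w_S$ denotes the value of $w\in\mathbb I\mathfrak m_X$ in $S$; in a group, $^{\mathfrak m}$ is the identity operation. For a relation $R$ on $\mathbb I\mathfrak m_X$, $\operatorname{FInv}\langle X\mid R\rangle$ is the quotient of the free $F$-inverse monoid on $X$ by the congruence generated by the pairs $(u,v)\in R$. Let $G$ be an $X$-generated group and $\Gamma_X$ its Cayley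 graph: the vertex set is $G$, and for all $g\in G$ and $a\in X\cup X^{-1}$ there is an edge labeled $a$ from $g$ to $ga_G$, whose inverse is the edge labeled $a^{-1}$ from $ga_G$ to $g$. Let $\operatorname{Sub}\Gamma_X$ be the lattice of all (not necessarily connected, possibly empty) subgraphs, that is, sets of vertices and edges closed under endpoints and inverses of edges. A term $w=u_0v_1^{\mathfrak m}u_1\cdots v_n^{\mathfrak m}u_n$ \emph{labels a journey from $g$ to $h$ in} $\Delta\in\operatorname{Sub}\Gamma_X$ if, starting at $g$ and alternately following the paths labeled $u_0,u_1,\dots,u_n$ and jumping from the current vertex $k$ to $k(v_i)_G$, one ends at $h$, and all these paths (including empty paths, which are single vertices) lie in $\Delta$. Given a relation $R$ on $\mathbb I\mathfrak m_X$ such that $u_G=v_G$ for all $(u,v)\in R$, a subgraph $\Delta$ is called closed if for all $(u,v)\in R$ and all vertices $g,h$ of $\Delta$, $u$ labels a journey from $g$ to $h$ in $\Delta$ if and only if $v$ does. There is a unique closure operator $c_R$ on $(\operatorname{Sub}\Gamma_X,\subseteq)$ with these closed elements. For an $X$-generated $F$-inverse monoid $S$ with $G=S/\sigma$, $c_S$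 is the closure operator obtained in this way from the relation $\{(u,v)\in \mathbb I\mathfrak m_X\times\mathbb I\mathfrak m_X : u_S=v_S\}$. \textbf{Proposition.} Let $X$ be a set, let $R$ be a relation on $\mathbb I\mathfrak m_X$, let $S=\operatorname{FInv}\langle X\mid R\rangle$, and let $G=S/\sigma$ be its greatest group image, with Cayley graph $\Gamma_X$. Then $c_R=c_S$ as closure operators on $(\operatorname{Sub}\Gamma_X,\subseteq)$. -/

import Mathlib

universe u v

/-! ## Inverse monoids, natural partial order, greatest group image -/

/-- Inverse monoids, as a variety in the signature `(·, 1, ⁻¹)`. -/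
class InverseMonoid (S : Type u) extends Monoid S, Inv S where
  mul_inv_mul_self : ∀ a : S, a * a⁻¹ * a = a
  inv_inv' : ∀ a : S, a⁻¹⁻¹ = a
  mul_inv_rev' : ∀ a b : S, (a * b)⁻¹ = b⁻¹ * a⁻¹
  idem_comm : ∀ a b : S, (a * a⁻¹) * (b * b⁻¹) = (b * b⁻¹) * (a * a⁻¹)

/-- The natural partial order of an inverse monoid: `a ≤ b` iff `a = a a⁻¹ b`. -/
def NatLE {S : Type u} [InverseMonoid S] (a b : S) : Prop := a = a * a⁻¹ * b

/-- `a σ b` iff `a` and `b` have a common lower bound in the natural partial order. -/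
def SigmaRel {S : Type u} [InverseMonoid S] (a b : S) : Prop := ∃ c, NatLE c a ∧ NatLE c b

namespace InverseMonoid

variable {S : Type u} [InverseMonoid S]

theorem proj_mul_proj (x y : S) :
    (x * x⁻¹ * y) * (x * x⁻¹ * y)⁻¹ = (x * x⁻¹) * (y * y⁻¹) := by
  have h := idem_comm x y
  have h2 : (x * x⁻¹) * (x * x⁻¹) = x * x⁻¹ := by
    rw [← mul_assoc, mul_inv_mul_self]
  rw [mul_inv_rev', mul_inv_rev', inv_inv']
  calc x * x⁻¹ * y * (y⁻¹ * (x * x⁻¹)) = x * x⁻¹ * ((y * y⁻¹) * (x * x⁻¹)) := by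
        simp only [mul_assoc]
    _ = (x * x⁻¹) * (x * x⁻¹) * (y * y⁻¹) := by rw [← h]; simp only [mul_assoc]
    _ = _ := by rw [h2]

theorem mul_proj (a y : S) : a * (y * y⁻¹) = (a * y) * (a * y)⁻¹ * a := by
  have h := idem_comm a⁻¹ y
  rw [inv_inv'] at h
  calc a * (y * y⁻¹) = a * a⁻¹ * a * (y * y⁻¹) := by rw [mul_inv_mul_self]
    _ = a * ((a⁻¹ * a) * (y * y⁻¹)) := by simp only [mul_assoc]
    _ = a * ((y * y⁻¹) * (a⁻¹ * a)) := by rw [h]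
    _ = _ := by rw [mul_inv_rev']; simp only [mul_assoc]

theorem natLE_of_eq {a b : S} (x : S) (h : a = x * x⁻¹ * b) : NatLE a b := by
  have h2 : a * a⁻¹ = (x * x⁻¹) * (b * b⁻¹) := by rw [h, proj_mul_proj]
  have h3 : b * b⁻¹ * b = b := mul_inv_mul_self b
  unfold NatLE
  rw [h2, mul_assoc, h3, ← h]

theorem natLE_antisymm {a b : S} (h : NatLE a b) (h' : NatLE b a) : a = b := by
  unfold NatLE at h h'
  calc a = a * a⁻¹ * b := h
    _ = a * a⁻¹ * (b * b⁻¹ * a) := by rw [← h']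
    _ = (a * a⁻¹) * (b * b⁻¹) * a := by simp only [mul_assoc]
    _ = (b * b⁻¹) * (a * a⁻¹) * a := by rw [idem_comm]
    _ = b * b⁻¹ * (a * a⁻¹ * a) := by simp only [mul_assoc]
    _ = b := by rw [mul_inv_mul_self, ← h']

theorem natLE_trans {a b c : S} (h : NatLE a b) (h' : NatLE b c) : NatLE a c := by
  refine natLE_of_eq (a * a⁻¹ * b) ?_
  rw [proj_mul_proj, mul_assoc (a * a⁻¹), ← h']
  exact h

theorem natLE_refl (a : S) : NatLE a a := (mul_inv_mul_self a).symm

theorem natLE_mul {a b c d : S} (h : NatLE a b) (h' : NatLE c d) : NatLE (a * c) (b * d) := by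
  refine natLE_of_eq (a * a⁻¹ * (b * c)) ?_
  rw [proj_mul_proj]
  calc a * c = (a * a⁻¹ * b) * (c * c⁻¹ * d) := by rw [← h, ← h']
    _ = a * a⁻¹ * (b * (c * c⁻¹)) * d := by simp only [mul_assoc]
    _ = _ := by rw [mul_proj]; simp only [mul_assoc]

theorem natLE_inv {a b : S} (h : NatLE a b) : NatLE a⁻¹ b⁻¹ := by
  refine natLE_of_eq (b⁻¹ * a) ?_
  rw [← mul_proj]
  conv_lhs => rw [h]
  simp only [mul_inv_rev', inv_inv']

theorem sigmaRel_of_natLE {a b : S} (h : NatLE a b) : SigmaRel a b := ⟨a, natLE_refl a, h⟩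

theorem sigmaRel_symm {a b : S} (h : SigmaRel a b) : SigmaRel b a :=
  let ⟨c, h1, h2⟩ := h; ⟨c, h2, h1⟩

theorem sigmaRel_trans {a b c : S} (h : SigmaRel a b) (h' : SigmaRel b c) : SigmaRel a c := by
  obtain ⟨x, hxa, hxb⟩ := h
  obtain ⟨y, hyb, hyc⟩ := h'
  refine ⟨(x * x⁻¹) * y, ?_, natLE_trans (natLE_of_eq x rfl) hyc⟩
  have : x * x⁻¹ * y = y * y⁻¹ * x := by
    calc x * x⁻¹ * y = x * x⁻¹ * (y * y⁻¹ * b) := by rw [← hyb]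
      _ = (x * x⁻¹) * (y * y⁻¹) * b := by simp only [mul_assoc]
      _ = (y * y⁻¹) * (x * x⁻¹ * b) := by rw [idem_comm]; simp only [mul_assoc]
      _ = _ := by rw [← hxb]
  rw [this]
  exact natLE_trans (natLE_of_eq y rfl) hxa

end InverseMonoid

/-- The least group congruence `σ` of an inverse monoid. -/
def sigmaCon (S : Type u) [InverseMonoid S] : Con S where
  r := SigmaRel
  iseqv := ⟨fun a => InverseMonoid.sigmaRel_of_natLE (InverseMonoid.natLE_refl a),
    InverseMonoid.sigmaRel_symm, InverseMonoid.sigmaRel_trans⟩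
  mul' := fun ⟨x, h1, h2⟩ ⟨y, h3, h4⟩ =>
    ⟨x * y, InverseMonoid.natLE_mul h1 h3, InverseMonoid.natLE_mul h2 h4⟩

/-- The greatest group image `S/σ`. -/
abbrev MaxGroupImage (S : Type u) [InverseMonoid S] : Type u := (sigmaCon S).Quotient

/-- The natural projection `S → S/σ`. -/
def sigmaProj (S : Type u) [InverseMonoid S] : S →* MaxGroupImage S := (sigmaCon S).mk'

instance MaxGroupImage.instGroup (S : Type u) [InverseMonoid S] : Group (MaxGroupImage S) where
  inv := Quotient.map (fun a : S => a⁻¹)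
    (fun _ _ ⟨x, h1, h2⟩ => ⟨x⁻¹, InverseMonoid.natLE_inv h1, InverseMonoid.natLE_inv h2⟩)
  inv_mul_cancel := by
    rintro ⟨a⟩
    refine (Con.eq (sigmaCon S)).2 (InverseMonoid.sigmaRel_of_natLE ?_)
    refine InverseMonoid.natLE_of_eq a⁻¹ ?_
    rw [InverseMonoid.inv_inv', mul_one]

/-! ## F-inverse monoids -/

/-- F-inverse monoids in the signature `(·, 1, ⁻¹, ᵐ)`: `mx a` is the greatest element of the
`σ`-class of `a` in the natural partial order. -/
class FInverseMonoid (S : Type u) extends InverseMonoid S where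
  mx : S → S
  mx_sigma : ∀ a : S, SigmaRel a (mx a)
  le_mx : ∀ a b : S, SigmaRel a b → NatLE b (mx a)

namespace FInverseMonoid

/-- An inverse monoid with a unary operation satisfying the two identities `a = a a⁻¹ aᵐ` and
`(y y⁻¹ a)ᵐ = aᵐ` is F-inverse. -/
abbrev ofIdentities {S : Type u} [InverseMonoid S] (m : S → S)
    (h1 : ∀ a, a = a * a⁻¹ * m a) (h2 : ∀ y a, m (y * y⁻¹ * a) = m a) : FInverseMonoid S where
  mx := m
  mx_sigma a := InverseMonoid.sigmaRel_of_natLE (h1 a)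
  le_mx a b := by
    rintro ⟨c, hca, hcb⟩
    have ha : m c = m a := by rw [hca, h2]
    have hb : m c = m b := by rw [hcb, h2]
    rw [← ha, hb]
    exact h1 b

variable {S : Type u} [FInverseMonoid S]

theorem le_mx_self (a : S) : a = a * a⁻¹ * mx a :=
  le_mx a a (InverseMonoid.sigmaRel_of_natLE (InverseMonoid.natLE_refl a))

theorem mx_proj_mul (y a : S) : mx (y * y⁻¹ * a) = mx a := by
  have h : SigmaRel (y * y⁻¹ * a) a :=
    InverseMonoid.sigmaRel_of_natLE (InverseMonoid.natLE_of_eq y rfl)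
  apply InverseMonoid.natLE_antisymm
  · exact le_mx _ _ (InverseMonoid.sigmaRel_trans (InverseMonoid.sigmaRel_symm h) (mx_sigma _))
  · exact le_mx _ _ (InverseMonoid.sigmaRel_trans h (mx_sigma _))

end FInverseMonoid

/-! ## Quotients of F-inverse monoids by generated congruences -/

/-- The congruence (in the signature `(·, 1, ⁻¹, ᵐ)`) generated by a relation `r`. -/
inductive FCongGen {S : Type u} [FInverseMonoid S] (r : S → S → Prop) : S → S → Prop
  | of {a b : S} : r a b → FCongGen r a b
  | refl (a : S) : FCongGen r a a
  | symm {a b : S} : FCongGen r a b → FCongGen r b a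
  | trans {a b c : S} : FCongGen r a b → FCongGen r b c → FCongGen r a c
  | mul {a b c d : S} : FCongGen r a b → FCongGen r c d → FCongGen r (a * c) (b * d)
  | inv {a b : S} : FCongGen r a b → FCongGen r a⁻¹ b⁻¹
  | mx {a b : S} : FCongGen r a b → FCongGen r (FInverseMonoid.mx a) (FInverseMonoid.mx b)

def fCongSetoid {S : Type u} [FInverseMonoid S] (r : S → S → Prop) : Setoid S :=
  ⟨FCongGen r, FCongGen.refl, FCongGen.symm, FCongGen.trans⟩

/-- The quotient of an F-inverse monoid by the congruence generated by `r`. -/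
def FQuot {S : Type u} [FInverseMonoid S] (r : S → S → Prop) : Type u := Quotient (fCongSetoid r)

namespace FQuot

variable {S : Type u} [FInverseMonoid S] {r : S → S → Prop}

def mk (r : S → S → Prop) (a : S) : FQuot r := Quotient.mk (fCongSetoid r) a

instance instInverseMonoid : InverseMonoid (FQuot r) where
  mul := Quotient.map₂ (· * ·) (fun _ _ h _ _ h' => FCongGen.mul h h')
  one := mk r 1
  inv := Quotient.map (·⁻¹) (fun _ _ h => FCongGen.inv h)
  mul_assoc := by rintro ⟨a⟩ ⟨b⟩ ⟨c⟩; exact congrArg (mk r) (mul_assoc a b c)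
  one_mul := by rintro ⟨a⟩; exact congrArg (mk r) (one_mul a)
  mul_one := by rintro ⟨a⟩; exact congrArg (mk r) (mul_one a)
  mul_inv_mul_self := by rintro ⟨a⟩; exact congrArg (mk r) (InverseMonoid.mul_inv_mul_self a)
  inv_inv' := by rintro ⟨a⟩; exact congrArg (mk r) (InverseMonoid.inv_inv' a)
  mul_inv_rev' := by rintro ⟨a⟩ ⟨b⟩; exact congrArg (mk r) (InverseMonoid.mul_inv_rev' a b)
  idem_comm := by rintro ⟨a⟩ ⟨b⟩; exact congrArg (mk r) (InverseMonoid.idem_comm a b)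

instance instFInverseMonoid : FInverseMonoid (FQuot r) :=
  FInverseMonoid.ofIdentities
    (Quotient.map FInverseMonoid.mx (fun _ _ h => FCongGen.mx h))
    (by rintro ⟨a⟩; exact congrArg (mk r) (FInverseMonoid.le_mx_self a))
    (by rintro ⟨y⟩ ⟨a⟩; exact congrArg (mk r) (FInverseMonoid.mx_proj_mul y a))

end FQuot

/-! ## The free F-inverse monoid -/

/-- All terms over `X` in the signature `(·, 1, ⁻¹, ᵐ)`. -/
inductive FTerm (X : Type u) : Type u
  | var : X → FTerm X
  | one : FTerm X
  | mul : FTerm X → FTerm X → FTerm X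
  | inv : FTerm X → FTerm X
  | mx : FTerm X → FTerm X

/-- Equality of terms in the variety of F-inverse monoids, generated by the defining identities. -/
inductive FTerm.Eqv {X : Type u} : FTerm X → FTerm X → Prop
  | refl (a) : Eqv a a
  | symm {a b} : Eqv a b → Eqv b a
  | trans {a b c} : Eqv a b → Eqv b c → Eqv a c
  | mul_congr {a b c d} : Eqv a b → Eqv c d → Eqv (mul a c) (mul b d)
  | inv_congr {a b} : Eqv a b → Eqv (inv a) (inv b)
  | mx_congr {a b} : Eqv a b → Eqv (mx a) (mx b)
  | mul_assoc (a b c) : Eqv (mul (mul a b) c) (mul a (mul b c))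
  | one_mul (a) : Eqv (mul one a) a
  | mul_one (a) : Eqv (mul a one) a
  | mul_inv_mul_self (a) : Eqv (mul (mul a (inv a)) a) a
  | inv_inv (a) : Eqv (inv (inv a)) a
  | mul_inv_rev (a b) : Eqv (inv (mul a b)) (mul (inv b) (inv a))
  | idem_comm (a b) : Eqv (mul (mul a (inv a)) (mul b (inv b))) (mul (mul b (inv b)) (mul a (inv a)))
  | le_mx (a) : Eqv a (mul (mul a (inv a)) (mx a))
  | mx_proj_mul (y a) : Eqv (mx (mul (mul y (inv y)) a)) (mx a)

def FTerm.setoid (X : Type u) : Setoid (FTerm X) :=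
  ⟨FTerm.Eqv, FTerm.Eqv.refl, FTerm.Eqv.symm, FTerm.Eqv.trans⟩

/-- The free F-inverse monoid on `X`. -/
def FreeFInverse (X : Type u) : Type u := Quotient (FTerm.setoid X)

namespace FreeFInverse

variable {X : Type u}

def of (x : X) : FreeFInverse X := Quotient.mk (FTerm.setoid X) (FTerm.var x)

instance instInverseMonoid : InverseMonoid (FreeFInverse X) where
  mul := Quotient.map₂ FTerm.mul (fun _ _ h _ _ h' => FTerm.Eqv.mul_congr h h')
  one := Quotient.mk (FTerm.setoid X) FTerm.one
  inv := Quotient.map FTerm.inv (fun _ _ h => FTerm.Eqv.inv_congr h)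
  mul_assoc := by rintro ⟨a⟩ ⟨b⟩ ⟨c⟩; exact Quotient.sound (FTerm.Eqv.mul_assoc a b c)
  one_mul := by rintro ⟨a⟩; exact Quotient.sound (FTerm.Eqv.one_mul a)
  mul_one := by rintro ⟨a⟩; exact Quotient.sound (FTerm.Eqv.mul_one a)
  mul_inv_mul_self := by rintro ⟨a⟩; exact Quotient.sound (FTerm.Eqv.mul_inv_mul_self a)
  inv_inv' := by rintro ⟨a⟩; exact Quotient.sound (FTerm.Eqv.inv_inv a)
  mul_inv_rev' := by rintro ⟨a⟩ ⟨b⟩; exact Quotient.sound (FTerm.Eqv.mul_inv_rev a b)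
  idem_comm := by rintro ⟨a⟩ ⟨b⟩; exact Quotient.sound (FTerm.Eqv.idem_comm a b)

instance instFInverseMonoid : FInverseMonoid (FreeFInverse X) :=
  FInverseMonoid.ofIdentities
    (Quotient.map FTerm.mx (fun _ _ h => FTerm.Eqv.mx_congr h))
    (by rintro ⟨a⟩; exact Quotient.sound (FTerm.Eqv.le_mx a))
    (by rintro ⟨y⟩ ⟨a⟩; exact Quotient.sound (FTerm.Eqv.mx_proj_mul y a))

end FreeFInverse

/-! ## Words, terms of the form `u₀ v₁ᵐ u₁ ⋯ vₙᵐ uₙ`, and presentations -/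

/-- `(X ∪ X⁻¹)*`; the letter `(x, true)` is `x` and `(x, false)` is the formal inverse `x⁻¹`. -/
abbrev InvWord (X : Type u) : Type u := List (X × Bool)

/-- The value of a letter of `X ∪ X⁻¹` under an assignment `ι` of the generators. -/
def letterVal {X : Type u} {M : Type v} [Inv M] (ι : X → M) (a : X × Bool) : M :=
  if a.2 then ι a.1 else (ι a.1)⁻¹

/-- The value of a word of `(X ∪ X⁻¹)*`. -/
def InvWord.val {X : Type u} {M : Type v} [Monoid M] [Inv M] (ι : X → M) (w : InvWord X) : M :=
  (w.map (letterVal ι)).prod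

/-- The symbols occurring in a formal expression `u₀ v₁ᵐ u₁ ⋯ vₙᵐ uₙ`: single letters of
`X ∪ X⁻¹`, and blocks `vᵐ` with `v` a word of `(X ∪ X⁻¹)*`. -/
inductive ImSymbol (X : Type u) : Type u
  | letter : X × Bool → ImSymbol X
  | jump : InvWord X → ImSymbol X

/-- The set of formal expressions `u₀ v₁ᵐ u₁ ⋯ vₙᵐ uₙ` with `uᵢ, vᵢ ∈ (X ∪ X⁻¹)*` and `n ≥ 0`,
each written as the sequence of its symbols. -/
abbrev ImTerm (X : Type u) : Type u := List (ImSymbol X)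

/-- The value `w_S` of a term in an F-inverse monoid `S`. -/
def ImTerm.val {X : Type u} {S : Type v} [FInverseMonoid S] (ι : X → S) : ImTerm X → S
  | [] => 1
  | .letter a :: w => letterVal ι a * ImTerm.val ι w
  | .jump v :: w => FInverseMonoid.mx (InvWord.val ι v) * ImTerm.val ι w

/-- The value `w_G` of a term in a group `G`, where `ᵐ` is the identity operation. -/
def ImTerm.groupVal {X : Type u} {G : Type v} [Group G] (ι : X → G) : ImTerm X → G
  | [] => 1
  | .letter a :: w => letterVal ι a * ImTerm.groupVal ι w
  | .jump v :: w => InvWord.val ι v * ImTerm.groupVal ι w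

/-- `FInv⟨X | R⟩`: the quotient of the free F-inverse monoid on `X` by the congruence generated by
the pairs of values of `R`-related terms. -/
abbrev PresentedFInverse {X : Type u} (R : ImTerm X → ImTerm X → Prop) : Type u :=
  FQuot (S := FreeFInverse X) fun a b =>
    ∃ s t : ImTerm X, R s t ∧ a = s.val FreeFInverse.of ∧ b = t.val FreeFInverse.of

/-- The canonical map `X → FInv⟨X | R⟩`. -/
def PresentedFInverse.of {X : Type u} (R : ImTerm X → ImTerm X → Prop) (x : X) :
    PresentedFInverse R :=
  FQuot.mk _ (FreeFInverse.of x)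

/-! ## Subgraphs of the Cayley graph of a group -/

/-- Edges of the Cayley graph: `(g, a)` is the edge labeled `a ∈ X ∪ X⁻¹` leaving the vertex `g`. -/
abbrev CayleyEdge (X : Type u) (G : Type v) : Type (max u v) := G × (X × Bool)

namespace CayleyEdge

variable {X : Type u} {G : Type v} [Group G]

def src (e : CayleyEdge X G) : G := e.1

def tgt (ι : X → G) (e : CayleyEdge X G) : G := e.1 * letterVal ι e.2

def rev (ι : X → G) (e : CayleyEdge X G) : CayleyEdge X G := (e.tgt ι, (e.2.1, !e.2.2))

end CayleyEdge

/-- Subgraphs of the Cayley graph of `G` with respect to `ι : X → G`: sets of vertices and edges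
closed under initial vertex, terminal vertex and inverse edge (possibly empty, not necessarily
connected). -/
@[ext]
structure CayleySubgraph {X : Type u} {G : Type v} [Group G] (ι : X → G) where
  verts : Set G
  edges : Set (CayleyEdge X G)
  src_mem : ∀ e ∈ edges, e.src ∈ verts
  tgt_mem : ∀ e ∈ edges, e.tgt ι ∈ verts
  rev_mem : ∀ e ∈ edges, e.rev ι ∈ edges

namespace CayleySubgraph

variable {X : Type u} {G : Type v} [Group G] {ι : X → G}

instance instPartialOrder : PartialOrder (CayleySubgraph ι) where
  le A B := A.verts ⊆ B.verts ∧ A.edges ⊆ B.edges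
  le_refl _ := ⟨subset_rfl, subset_rfl⟩
  le_trans _ _ _ h h' := ⟨h.1.trans h'.1, h.2.trans h'.2⟩
  le_antisymm _ _ h h' := CayleySubgraph.ext (h.1.antisymm h'.1) (h.2.antisymm h'.2)

instance instInfSet : InfSet (CayleySubgraph ι) where
  sInf Y :=
    { verts := {g | ∀ A ∈ Y, g ∈ A.verts}
      edges := {e | ∀ A ∈ Y, e ∈ A.edges}
      src_mem := fun e he A hA => A.src_mem e (he A hA)
      tgt_mem := fun e he A hA => A.tgt_mem e (he A hA)
      rev_mem := fun e he A hA => A.rev_mem e (he A hA) }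

instance instCompleteLattice : CompleteLattice (CayleySubgraph ι) :=
  completeLatticeOfInf _ fun _ =>
    ⟨fun A hA => And.intro (fun _ (h : ∀ A ∈ _, _) => h A hA) (fun _ (h : ∀ A ∈ _, _) => h A hA),
      fun _ hB => And.intro (fun _ hg _ hA => (hB hA).1 hg) (fun _ he _ hA => (hB hA).2 he)⟩

/-- `Δ.IsJourney w g h`: the term `w` labels a journey from `g` to `h` in `Δ`. A letter of `w` is
read by traversing an edge of `Δ`; a block `vᵐ` is read by jumping from the current vertex `k` of
`Δ` to the vertex `k v_G`, which must also belong to `Δ`. -/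
def IsJourney (Δ : CayleySubgraph ι) : ImTerm X → G → G → Prop
  | [], g, h => g ∈ Δ.verts ∧ g = h
  | .letter a :: w, g, h => (g, a) ∈ Δ.edges ∧ IsJourney Δ w (g * letterVal ι a) h
  | .jump v :: w, g, h => g ∈ Δ.verts ∧ IsJourney Δ w (g * InvWord.val ι v) h

/-- `Δ` is closed for `R`: for `(s, t) ∈ R` and vertices `g, h` of `Δ`, the term `s` labels a
journey from `g` to `h` in `Δ` iff `t` does. -/
def IsRelClosed (R : ImTerm X → ImTerm X → Prop) (Δ : CayleySubgraph ι) : Prop :=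
  ∀ s t, R s t → ∀ g ∈ Δ.verts, ∀ h ∈ Δ.verts, (Δ.IsJourney s g h ↔ Δ.IsJourney t g h)

theorem IsJourney.eq {Δ : CayleySubgraph ι} {w : ImTerm X} {g h : G} (hj : Δ.IsJourney w g h) :
    h = g * w.groupVal ι := by
  induction w generalizing g with
  | nil => simpa [ImTerm.groupVal] using hj.2.symm
  | cons a w ih => cases a <;> simpa [ImTerm.groupVal, mul_assoc] using ih hj.2

theorem isJourney_sInf {Y : Set (CayleySubgraph ι)} (w : ImTerm X) (g h : G)
    (hh : h = g * w.groupVal ι) :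
    (sInf Y).IsJourney w g h ↔ ∀ A ∈ Y, A.IsJourney w g h := by
  induction w generalizing g with
  | nil =>
    have : g = h := by simpa [ImTerm.groupVal] using hh.symm
    exact ⟨fun h A hA => ⟨h.1 A hA, this⟩, fun h => ⟨fun A hA => (h A hA).1, this⟩⟩
  | cons a w ih =>
    cases a with
    | letter a =>
      have ih := ih (g * letterVal ι a) (by rw [hh, ImTerm.groupVal, mul_assoc])
      exact ⟨fun h A hA => ⟨h.1 A hA, ih.1 h.2 A hA⟩,
        fun h => ⟨fun A hA => (h A hA).1, ih.2 fun A hA => (h A hA).2⟩⟩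
    | jump v =>
      have ih := ih (g * InvWord.val ι v) (by rw [hh, ImTerm.groupVal, mul_assoc])
      exact ⟨fun h A hA => ⟨h.1 A hA, ih.1 h.2 A hA⟩,
        fun h => ⟨fun A hA => (h A hA).1, ih.2 fun A hA => (h A hA).2⟩⟩

theorem isRelClosed_sInf {R : ImTerm X → ImTerm X → Prop}
    (hR : ∀ s t, R s t → s.groupVal ι = t.groupVal ι) (Y : Set (CayleySubgraph ι))
    (hY : ∀ A ∈ Y, IsRelClosed R A) : IsRelClosed R (sInf Y) := by
  intro s t hst g hg h hh
  have e := hR s t hst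
  constructor
  · intro hj
    have hs := hj.eq
    rw [isJourney_sInf _ _ _ hs] at hj
    rw [isJourney_sInf _ _ _ (e ▸ hs)]
    exact fun A hA => (hY A hA s t hst g (hg A hA) h (hh A hA)).1 (hj A hA)
  · intro hj
    have ht := hj.eq
    rw [isJourney_sInf _ _ _ ht] at hj
    rw [isJourney_sInf _ _ _ (e.symm ▸ ht)]
    exact fun A hA => (hY A hA s t hst g (hg A hA) h (hh A hA)).2 (hj A hA)

end CayleySubgraph

/-! ## The closure operators -/

/-- The closure operator on the lattice of subgraphs of the Cayley graph of `G` whose closed elements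
are the subgraphs closed for `R`, where `R`-related terms are equal in `G`. -/
def relClosure {X : Type u} {G : Type v} [Group G] (ι : X → G) (R : ImTerm X → ImTerm X → Prop)
    (hR : ∀ s t, R s t → s.groupVal ι = t.groupVal ι) : ClosureOperator (CayleySubgraph ι) :=
  ClosureOperator.ofCompletePred (CayleySubgraph.IsRelClosed R)
    (CayleySubgraph.isRelClosed_sInf hR)

/-- The canonical map `X → S/σ`. -/
def groupGen {X : Type u} {S : Type v} [InverseMonoid S] (ι : X → S) : X → MaxGroupImage S :=
  fun x => sigmaProj S (ι x)

theorem letterVal_groupGen {X : Type u} {S : Type v} [InverseMonoid S] (ι : X → S)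
    (a : X × Bool) : letterVal (groupGen ι) a = sigmaProj S (letterVal ι a) := by
  unfold letterVal
  split <;> rfl

theorem InvWord.val_groupGen {X : Type u} {S : Type v} [InverseMonoid S] (ι : X → S)
    (w : InvWord X) : w.val (groupGen ι) = sigmaProj S (w.val ι) := by
  simp only [InvWord.val, map_list_prod, List.map_map]
  congr 1
  exact List.map_congr_left fun a _ => letterVal_groupGen ι a

theorem ImTerm.groupVal_groupGen {X : Type u} {S : Type v} [FInverseMonoid S] (ι : X → S)
    (w : ImTerm X) : w.groupVal (groupGen ι) = sigmaProj S (w.val ι) := by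
  induction w with
  | nil => exact (map_one (sigmaProj S)).symm
  | cons a w ih =>
    cases a with
    | letter a => rw [ImTerm.groupVal, ImTerm.val, map_mul, ih, letterVal_groupGen]
    | jump v =>
      rw [ImTerm.groupVal, ImTerm.val, map_mul, ih, InvWord.val_groupGen]
      congr 1
      exact (Con.eq (sigmaCon S)).2 (FInverseMonoid.mx_sigma _)

/-- The closure operator `c_S` of an F-inverse monoid `S` with generators `ι : X → S`, on the subgraphs
of the Cayley graph of `S/σ`: it comes from the relation `s_S = t_S` on terms. -/
def monoidClosure {X : Type u} {S : Type v} [FInverseMonoid S] (ι : X → S) :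
    ClosureOperator (CayleySubgraph (groupGen ι)) :=
  relClosure (groupGen ι) (fun s t => s.val ι = t.val ι) fun s t h => by
    rw [ImTerm.groupVal_groupGen, ImTerm.groupVal_groupGen, h]

theorem PresentedFInverse.val_of {X : Type u} (R : ImTerm X → ImTerm X → Prop) (w : ImTerm X) :
    w.val (PresentedFInverse.of R) = FQuot.mk _ (w.val FreeFInverse.of) := by
  have hl : ∀ a : X × Bool, letterVal (PresentedFInverse.of R) a =
      FQuot.mk _ (letterVal FreeFInverse.of a) := by
    intro a
    unfold letterVal
    split <;> rfl
  have hw : ∀ v : InvWord X, v.val (PresentedFInverse.of R) =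
      FQuot.mk _ (v.val FreeFInverse.of) := by
    intro v
    induction v with
    | nil => rfl
    | cons a v ih =>
      have ih' : (List.map (letterVal (PresentedFInverse.of R)) v).prod = _ := ih
      rw [InvWord.val, List.map_cons, List.prod_cons, ih', hl]
      rfl
  induction w with
  | nil => rfl
  | cons a w ih =>
    cases a with
    | letter a => rw [ImTerm.val, ih, hl]; rfl
    | jump v => rw [ImTerm.val, ih, hw]; rfl

theorem PresentedFInverse.val_eq {X : Type u} {R : ImTerm X → ImTerm X → Prop} {s t : ImTerm X}
    (h : R s t) : s.val (PresentedFInverse.of R) = t.val (PresentedFInverse.of R) := by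
  rw [PresentedFInverse.val_of, PresentedFInverse.val_of]
  exact Quotient.sound (FCongGen.of ⟨s, t, h, rfl, rfl⟩)

/-- The closure operator `c_R` of a presentation `FInv⟨X | R⟩`, on the subgraphs of the Cayley graph
of the greatest group image of the presented F-inverse monoid. -/
def presentationClosure {X : Type u} (R : ImTerm X → ImTerm X → Prop) :
    ClosureOperator (CayleySubgraph (groupGen (PresentedFInverse.of R))) :=
  relClosure (groupGen (PresentedFInverse.of R)) R fun s t h => by
    rw [ImTerm.groupVal_groupGen, ImTerm.groupVal_groupGen, PresentedFInverse.val_eq h]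

/-!
A subgraph `Δ` of the Cayley graph of `G` determines an F-inverse monoid, that of the partial right
translations of its vertex set, and an assignment of `X` in it which sends `x` to the translation
along the edges of `Δ` labeled `x`. The value of a term `w` under this assignment is the translation
by `w_G` restricted to the vertices at which `w` labels a journey in `Δ`, so that `Δ` is closed for
a relation valid in `G` exactly when that relation holds in the monoid of partial translations. By
the universal property of `FInv⟨X | R⟩`, a monoid satisfying `R` satisfies every equality of terms
that holds in `FInv⟨X | R⟩`.
-/

universe w

/-! ## Homomorphisms and values of terms -/

section Values

variable {X : Type u}

theorem map_letterVal {M : Type v} {N : Type w} [Inv M] [Inv N] {f : M → N}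
    (hf : ∀ m, f m⁻¹ = (f m)⁻¹) (ι : X → M) (a : X × Bool) :
    f (letterVal ι a) = letterVal (f ∘ ι) a := by
  unfold letterVal
  split
  · rfl
  · exact hf _

theorem InvWord.map_val {M : Type v} {N : Type w} [Monoid M] [Inv M] [Monoid N] [Inv N]
    {F : Type*} [FunLike F M N] [MonoidHomClass F M N] {f : F}
    (hf : ∀ m, f m⁻¹ = (f m)⁻¹) (ι : X → M) (v : InvWord X) :
    f (v.val ι) = v.val (f ∘ ι) := by
  simp only [InvWord.val, map_list_prod, List.map_map]
  congr 2
  exact funext (map_letterVal hf ι)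

end Values

/-- Homomorphisms of F-inverse monoids in the signature `(·, 1, ⁻¹, ᵐ)`. -/
structure FInverseHom (S : Type v) (T : Type w) [FInverseMonoid S] [FInverseMonoid T]
    extends S →* T where
  map_inv' : ∀ a, toFun a⁻¹ = (toFun a)⁻¹
  map_mx' : ∀ a, toFun (FInverseMonoid.mx a) = FInverseMonoid.mx (toFun a)

namespace FInverseHom

variable {S : Type v} {T : Type w} [FInverseMonoid S] [FInverseMonoid T]

instance : FunLike (FInverseHom S T) S T where
  coe f := f.toFun
  coe_injective f g h := by
    obtain ⟨f, _, _⟩ := f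
    obtain ⟨g, _, _⟩ := g
    congr
    exact DFunLike.coe_injective h

instance : MonoidHomClass (FInverseHom S T) S T where
  map_mul f := f.map_mul'
  map_one f := f.map_one'

theorem map_inv (f : FInverseHom S T) (a : S) : f a⁻¹ = (f a)⁻¹ := f.map_inv' a

theorem map_mx (f : FInverseHom S T) (a : S) :
    f (FInverseMonoid.mx a) = FInverseMonoid.mx (f a) := f.map_mx' a

theorem map_imTermVal {X : Type u} (f : FInverseHom S T) (ι : X → S) (t : ImTerm X) :
    f (t.val ι) = t.val (f ∘ ι) := by
  induction t with
  | nil => exact map_one f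
  | cons a t ih =>
    cases a with
    | letter a => rw [ImTerm.val, ImTerm.val, map_mul, map_letterVal f.map_inv, ih]
    | jump v => rw [ImTerm.val, ImTerm.val, map_mul, map_mx, InvWord.map_val f.map_inv, ih]

end FInverseHom

section GroupImages

variable {X : Type u} {S : Type v} {G : Type w} [Group G]

theorem InverseMonoid.map_inv_group [InverseMonoid S] (f : S →* G) (a : S) :
    f a⁻¹ = (f a)⁻¹ := by
  have h : f a * f a⁻¹ * f a = f a := by
    rw [← map_mul, ← map_mul, InverseMonoid.mul_inv_mul_self]
  exact eq_inv_of_mul_eq_one_right (mul_eq_right.1 h)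

theorem FInverseMonoid.map_mx_group [FInverseMonoid S] (f : S →* G) (a : S) :
    f (FInverseMonoid.mx a) = f a := by
  conv_rhs => rw [FInverseMonoid.le_mx_self a]
  rw [map_mul, map_mul, InverseMonoid.map_inv_group, mul_inv_cancel, one_mul]

theorem ImTerm.map_val_group [FInverseMonoid S] (f : S →* G) (ι : X → S) (t : ImTerm X) :
    f (t.val ι) = t.groupVal (f ∘ ι) := by
  have map_inv := InverseMonoid.map_inv_group f
  induction t with
  | nil => exact map_one f
  | cons a t ih =>
    cases a with
    | letter a => rw [ImTerm.val, ImTerm.groupVal, map_mul, map_letterVal map_inv, ih]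
    | jump v =>
      rw [ImTerm.val, ImTerm.groupVal, map_mul, FInverseMonoid.map_mx_group,
        InvWord.map_val map_inv, ih]

end GroupImages

/-! ## Universal properties -/

/-- The value of a term of the full signature under an assignment `ι` of the variables. -/
def FTerm.eval {X : Type u} {S : Type v} [FInverseMonoid S] (ι : X → S) : FTerm X → S
  | .var x => ι x
  | .one => 1
  | .mul a b => a.eval ι * b.eval ι
  | .inv a => (a.eval ι)⁻¹
  | .mx a => FInverseMonoid.mx (a.eval ι)

theorem FTerm.Eqv.eval_eq {X : Type u} {S : Type v} [FInverseMonoid S] (ι : X → S)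
    {a b : FTerm X} (h : FTerm.Eqv a b) : a.eval ι = b.eval ι := by
  induction h with
  | refl => rfl
  | symm _ ih => exact ih.symm
  | trans _ _ ih ih' => exact ih.trans ih'
  | mul_congr _ _ ih ih' => simp only [FTerm.eval, ih, ih']
  | inv_congr _ ih => simp only [FTerm.eval, ih]
  | mx_congr _ ih => simp only [FTerm.eval, ih]
  | mul_assoc => exact _root_.mul_assoc _ _ _
  | one_mul => exact _root_.one_mul _
  | mul_one => exact _root_.mul_one _
  | mul_inv_mul_self => exact InverseMonoid.mul_inv_mul_self _
  | inv_inv => exact InverseMonoid.inv_inv' _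
  | mul_inv_rev => exact InverseMonoid.mul_inv_rev' _ _
  | idem_comm => exact InverseMonoid.idem_comm _ _
  | le_mx => exact FInverseMonoid.le_mx_self _
  | mx_proj_mul => exact FInverseMonoid.mx_proj_mul _ _

/-- The homomorphism from the free F-inverse monoid on `X` extending a map `ι : X → S`. -/
def FreeFInverse.lift {X : Type u} {S : Type v} [FInverseMonoid S] (ι : X → S) :
    FInverseHom (FreeFInverse X) S where
  toFun := Quotient.lift (FTerm.eval ι) fun _ _ h => FTerm.Eqv.eval_eq ι h
  map_one' := rfl
  map_mul' := by rintro ⟨a⟩ ⟨b⟩; rfl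
  map_inv' := by rintro ⟨a⟩; rfl
  map_mx' := by rintro ⟨a⟩; rfl

theorem FreeFInverse.lift_comp_of {X : Type u} {S : Type v} [FInverseMonoid S] (ι : X → S) :
    FreeFInverse.lift ι ∘ FreeFInverse.of = ι := rfl

theorem FCongGen.map_eq {S : Type v} {T : Type w} [FInverseMonoid S] [FInverseMonoid T]
    {r : S → S → Prop} (f : FInverseHom S T) (hf : ∀ a b, r a b → f a = f b) {a b : S}
    (h : FCongGen r a b) : f a = f b := by
  induction h with
  | of h => exact hf _ _ h
  | refl => rfl
  | symm _ ih => exact ih.symm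
  | trans _ _ ih ih' => exact ih.trans ih'
  | mul _ _ ih ih' => rw [map_mul, map_mul, ih, ih']
  | inv _ ih => rw [f.map_inv, f.map_inv, ih]
  | mx _ ih => rw [f.map_mx, f.map_mx, ih]

/-- The factorization through `FQuot r` of a homomorphism that identifies `r`-related elements. -/
def FQuot.lift {S : Type v} {T : Type w} [FInverseMonoid S] [FInverseMonoid T]
    {r : S → S → Prop} (f : FInverseHom S T) (hf : ∀ a b, r a b → f a = f b) :
    FInverseHom (FQuot r) T where
  toFun := Quotient.lift f fun _ _ h => FCongGen.map_eq f hf h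
  map_one' := map_one f
  map_mul' := by rintro ⟨a⟩ ⟨b⟩; exact map_mul f a b
  map_inv' := by rintro ⟨a⟩; exact f.map_inv a
  map_mx' := by rintro ⟨a⟩; exact f.map_mx a

namespace PresentedFInverse

variable {X : Type u} {S : Type v} [FInverseMonoid S] {R : ImTerm X → ImTerm X → Prop}

/-- The homomorphism from `FInv⟨X | R⟩` extending a map `ι : X → S` under which `R` holds in `S`. -/
def lift (ι : X → S) (hι : ∀ s t, R s t → s.val ι = t.val ι) :
    FInverseHom (PresentedFInverse R) S :=
  FQuot.lift (FreeFInverse.lift ι) <| by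
    rintro _ _ ⟨s, t, hst, rfl, rfl⟩
    simpa only [FInverseHom.map_imTermVal, FreeFInverse.lift_comp_of] using hι s t hst

theorem lift_comp_of (ι : X → S) (hι : ∀ s t, R s t → s.val ι = t.val ι) :
    lift ι hι ∘ of R = ι := rfl

theorem val_eq_of_val_of_eq (ι : X → S) (hι : ∀ s t, R s t → s.val ι = t.val ι)
    {s t : ImTerm X} (h : s.val (of R) = t.val (of R)) : s.val ι = t.val ι := by
  simpa only [FInverseHom.map_imTermVal, lift_comp_of] using congrArg (lift ι hι) h

end PresentedFInverse

/-! ## Partial translations of a subset of a group -/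

/-- Partial right translations of a subset `V` of a group: restrictions of `g ↦ g * shift` to sets
`dom ⊆ V` whose image lies in `V`. The translating element is part of the data, so that the empty
translations with different shifts are distinct and `shift` is a homomorphism to the group. -/
@[ext]
structure PartialTranslation {G : Type v} [Group G] (V : Set G) where
  dom : Set G
  shift : G
  dom_subset : dom ⊆ V
  mul_shift_mem : ∀ g ∈ dom, g * shift ∈ V

namespace PartialTranslation

variable {G : Type v} [Group G] {V : Set G}

instance : Mul (PartialTranslation V) where
  mul a b :=
    { dom := {g | g ∈ a.dom ∧ g * a.shift ∈ b.dom}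
      shift := a.shift * b.shift
      dom_subset := fun _ hg => a.dom_subset hg.1
      mul_shift_mem := fun g hg => mul_assoc g _ _ ▸ b.mul_shift_mem _ hg.2 }

instance : One (PartialTranslation V) where
  one := ⟨V, 1, subset_rfl, fun g hg => (mul_one g).symm ▸ hg⟩

instance : Inv (PartialTranslation V) where
  inv a :=
    { dom := {g | g * a.shift⁻¹ ∈ a.dom}
      shift := a.shift⁻¹
      dom_subset := fun g hg => inv_mul_cancel_right g a.shift ▸ a.mul_shift_mem _ hg
      mul_shift_mem := fun _ hg => a.dom_subset hg }

@[simp] theorem shift_mul (a b : PartialTranslation V) : (a * b).shift = a.shift * b.shift := rfl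

@[simp] theorem mem_dom_mul (a b : PartialTranslation V) (g : G) :
    g ∈ (a * b).dom ↔ g ∈ a.dom ∧ g * a.shift ∈ b.dom := Iff.rfl

@[simp] theorem shift_one : (1 : PartialTranslation V).shift = 1 := rfl

@[simp] theorem mem_dom_one (g : G) : g ∈ (1 : PartialTranslation V).dom ↔ g ∈ V := Iff.rfl

@[simp] theorem shift_inv (a : PartialTranslation V) : a⁻¹.shift = a.shift⁻¹ := rfl

@[simp] theorem mem_dom_inv (a : PartialTranslation V) (g : G) :
    g ∈ a⁻¹.dom ↔ g * a.shift⁻¹ ∈ a.dom := Iff.rfl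

instance : InverseMonoid (PartialTranslation V) where
  mul_assoc a b c := by ext <;> simp [mul_assoc, and_assoc]
  one_mul a := by
    ext g
    · simpa using @a.dom_subset g
    · simp
  mul_one a := by
    ext g
    · simpa using a.mul_shift_mem g
    · simp
  mul_inv_mul_self a := by ext <;> simp
  inv_inv' a := by ext <;> simp
  mul_inv_rev' a b := by ext <;> simp [mul_assoc, and_comm]
  idem_comm a b := by ext <;> simp [and_comm]

/-- The largest partial translation of `V` by `γ`; it is the greatest element of its `σ`-class. -/
def maximal (V : Set G) (γ : G) : PartialTranslation V :=
  ⟨{g | g ∈ V ∧ g * γ ∈ V}, γ, fun _ hg => hg.1, fun _ hg => hg.2⟩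

@[simp] theorem shift_maximal (γ : G) : (maximal V γ).shift = γ := rfl

@[simp] theorem mem_dom_maximal (γ g : G) : g ∈ (maximal V γ).dom ↔ g ∈ V ∧ g * γ ∈ V := Iff.rfl

instance : FInverseMonoid (PartialTranslation V) :=
  FInverseMonoid.ofIdentities (fun a => maximal V a.shift)
    (fun a => by
      ext g
      · simpa using fun h => ⟨a.dom_subset h, a.mul_shift_mem g h⟩
      · simp)
    (fun y a => by simp)

theorem mx_eq_maximal (a : PartialTranslation V) : FInverseMonoid.mx a = maximal V a.shift := rfl

/-- `PartialTranslation.shift` as a homomorphism to the group. -/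
def shiftHom (V : Set G) : PartialTranslation V →* G where
  toFun := shift
  map_one' := shift_one
  map_mul' := shift_mul

end PartialTranslation

/-! ## Journeys and partial translations -/

theorem CayleyEdge.rev_rev {X : Type u} {G : Type v} [Group G] (ι : X → G)
    (e : CayleyEdge X G) : (e.rev ι).rev ι = e := by
  obtain ⟨g, x, _ | _⟩ := e <;> simp [CayleyEdge.rev, CayleyEdge.tgt, letterVal]

namespace CayleySubgraph

variable {X : Type u} {G : Type v} [Group G] {ι : X → G}

theorem rev_mem_edges_iff (Δ : CayleySubgraph ι) (e : CayleyEdge X G) :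
    e.rev ι ∈ Δ.edges ↔ e ∈ Δ.edges :=
  ⟨fun h => e.rev_rev ι ▸ Δ.rev_mem _ h, Δ.rev_mem e⟩

theorem IsJourney.source_mem {Δ : CayleySubgraph ι} {t : ImTerm X} {g h : G}
    (hj : Δ.IsJourney t g h) : g ∈ Δ.verts := by
  match t, hj with
  | [], hj => exact hj.1
  | .letter _ :: _, hj => exact Δ.src_mem _ hj.1
  | .jump _ :: _, hj => exact hj.1

theorem IsJourney.target_mem {Δ : CayleySubgraph ι} {t : ImTerm X} {g h : G}
    (hj : Δ.IsJourney t g h) : h ∈ Δ.verts := by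
  induction t generalizing g with
  | nil => exact hj.2 ▸ hj.1
  | cons a t ih => cases a <;> exact ih hj.2

/-- The partial translation of the vertices of `Δ` along its edges labeled `x`. -/
def edgeTranslation (Δ : CayleySubgraph ι) (x : X) : PartialTranslation Δ.verts where
  dom := {g | (g, (x, true)) ∈ Δ.edges}
  shift := ι x
  dom_subset _ hg := Δ.src_mem _ hg
  mul_shift_mem _ hg := Δ.tgt_mem _ hg

variable (Δ : CayleySubgraph ι)

theorem shift_letterVal (a : X × Bool) :
    (letterVal Δ.edgeTranslation a).shift = letterVal ι a :=
  map_letterVal PartialTranslation.shift_inv Δ.edgeTranslation a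

theorem shift_invWordVal (v : InvWord X) : (v.val Δ.edgeTranslation).shift = v.val ι :=
  InvWord.map_val (f := PartialTranslation.shiftHom Δ.verts) PartialTranslation.shift_inv
    Δ.edgeTranslation v

theorem shift_imTermVal (t : ImTerm X) : (t.val Δ.edgeTranslation).shift = t.groupVal ι :=
  t.map_val_group (PartialTranslation.shiftHom Δ.verts) Δ.edgeTranslation

theorem mem_dom_letterVal (a : X × Bool) (g : G) :
    g ∈ (letterVal Δ.edgeTranslation a).dom ↔ (g, a) ∈ Δ.edges := by
  obtain ⟨x, _ | _⟩ := a
  · exact Δ.rev_mem_edges_iff (g, (x, false))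
  · exact Iff.rfl

theorem mem_dom_imTermVal (t : ImTerm X) (g : G) :
    g ∈ (t.val Δ.edgeTranslation).dom ↔ Δ.IsJourney t g (g * t.groupVal ι) := by
  induction t generalizing g with
  | nil => simp [ImTerm.val, ImTerm.groupVal, IsJourney]
  | cons a t ih =>
    cases a with
    | letter a =>
      rw [ImTerm.val, ImTerm.groupVal, PartialTranslation.mem_dom_mul, mem_dom_letterVal,
        shift_letterVal, ih, mul_assoc, IsJourney]
    | jump v =>
      rw [ImTerm.val, ImTerm.groupVal, PartialTranslation.mem_dom_mul,
        PartialTranslation.mx_eq_maximal, PartialTranslation.mem_dom_maximal,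
        PartialTranslation.shift_maximal, shift_invWordVal, ih, mul_assoc, IsJourney]
      exact ⟨fun h => ⟨h.1.1, h.2⟩, fun h => ⟨⟨h.1, h.2.source_mem⟩, h.2⟩⟩

theorem isJourney_iff (t : ImTerm X) (g h : G) :
    Δ.IsJourney t g h ↔
      g ∈ (t.val Δ.edgeTranslation).dom ∧ h = g * (t.val Δ.edgeTranslation).shift := by
  rw [mem_dom_imTermVal, shift_imTermVal]
  exact ⟨fun hj => ⟨hj.eq ▸ hj, hj.eq⟩, fun ⟨hj, hh⟩ => hh ▸ hj⟩

theorem imTermVal_eq_iff {s t : ImTerm X} (hst : s.groupVal ι = t.groupVal ι) :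
    s.val Δ.edgeTranslation = t.val Δ.edgeTranslation ↔
      ∀ g ∈ Δ.verts, ∀ h ∈ Δ.verts, (Δ.IsJourney s g h ↔ Δ.IsJourney t g h) := by
  constructor
  · intro heq g _ h _
    rw [isJourney_iff, isJourney_iff, heq]
  · intro hΔ
    refine PartialTranslation.ext (Set.ext fun g => ?_) ?_
    · rw [mem_dom_imTermVal, mem_dom_imTermVal, ← hst]
      exact ⟨fun hs => (hΔ g hs.source_mem _ hs.target_mem).1 hs,
        fun ht => (hΔ g ht.source_mem _ ht.target_mem).2 ht⟩
    · rw [shift_imTermVal, shift_imTermVal, hst]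

theorem isRelClosed_iff {R : ImTerm X → ImTerm X → Prop}
    (hR : ∀ s t, R s t → s.groupVal ι = t.groupVal ι) :
    Δ.IsRelClosed R ↔ ∀ s t, R s t → s.val Δ.edgeTranslation = t.val Δ.edgeTranslation :=
  forall₃_congr fun s t hst => (Δ.imTermVal_eq_iff (hR s t hst)).symm

end CayleySubgraph

section Presentations

variable {X : Type u} {G : Type v} [Group G] {ι : X → G} {R : ImTerm X → ImTerm X → Prop}

theorem PresentedFInverse.groupVal_eq_of_val_of_eq
    (hR : ∀ s t, R s t → s.groupVal ι = t.groupVal ι) {s t : ImTerm X}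
    (h : s.val (PresentedFInverse.of R) = t.val (PresentedFInverse.of R)) :
    s.groupVal ι = t.groupVal ι := by
  -- The empty intersection is the whole Cayley graph.
  have hclosed : (sInf ∅ : CayleySubgraph ι).IsRelClosed R :=
    CayleySubgraph.isRelClosed_sInf hR ∅ (by simp)
  rw [CayleySubgraph.isRelClosed_iff _ hR] at hclosed
  have heq := PresentedFInverse.val_eq_of_val_of_eq _ hclosed h
  simpa only [CayleySubgraph.shift_imTermVal] using congrArg PartialTranslation.shift heq

theorem CayleySubgraph.isRelClosed_iff_isRelClosed_val_of_eq
    (hR : ∀ s t, R s t → s.groupVal ι = t.groupVal ι) (Δ : CayleySubgraph ι) :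
    Δ.IsRelClosed R ↔ Δ.IsRelClosed fun s t =>
      s.val (PresentedFInverse.of R) = t.val (PresentedFInverse.of R) := by
  constructor
  · intro hΔ
    rw [CayleySubgraph.isRelClosed_iff Δ hR] at hΔ
    rw [CayleySubgraph.isRelClosed_iff Δ fun _ _ =>
      PresentedFInverse.groupVal_eq_of_val_of_eq hR]
    exact fun s t => PresentedFInverse.val_eq_of_val_of_eq _ hΔ
  · exact fun hΔ s t hst => hΔ s t (PresentedFInverse.val_eq hst)

end Presentations

theorem mainTheorem5_general {X : Type u} {G : Type v} [Group G] (ι : X → G)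
    (R : ImTerm X → ImTerm X → Prop) (hR : ∀ s t, R s t → s.groupVal ι = t.groupVal ι) :
    relClosure ι R hR =
      relClosure ι (fun s t => s.val (PresentedFInverse.of R) = t.val (PresentedFInverse.of R))
        (fun _ _ => PresentedFInverse.groupVal_eq_of_val_of_eq hR) := by
  unfold relClosure
  congr 1
  exact funext fun Δ => propext (Δ.isRelClosed_iff_isRelClosed_val_of_eq hR)

theorem mainTheorem5 {X : Type u} (R : ImTerm X → ImTerm X → Prop) :
    presentationClosure R = monoidClosure (PresentedFInverse.of R) :=
  mainTheorem5_general (groupGen (PresentedFInverse.of R)) R _
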